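/- Let $0<a<b$, let $D_r\subset\mathbb{R}^2$ denote the closed disk of radius $r$ centred at the origin, and let $$\mathscr{C}_{a,b}=\{K\subseteq\mathbb{R}^2 : K \text{ convex},\ D_a\subseteq K\subseteq D_b\}.$$ For $\lambda\in\mathbb{R}$ and $K\in\mathscr{C}_{a,b}$ put $J_\lambda(K)=\lambda|K|-P(K)$, where $|K|$ is the area of $K$ and $P(K)$ is its perimeter, i.e. the length (one-dimensional Hausdorff measure) of $\partial K$. Suppose that $$\frac{1}{2b}<\lambda<\frac{2}{a}$$ and that $\Omega_\lambda\in\mathscr{C}_{a,b}$ minimizes $J_\lambda$ over $\mathscr{C}_{a,b}$, that is, $J_\lambda(\Omega_\lambda)\le J_\lambda(K)$ for all $K\in\mathscr{C}_{a,b}$. Then $\partial\Omega_\lambda$ contains no arc of $\partial D_a$ and no arc of $\partial D_b$: for $r\in\{a,b\}$ there are no real numbers $\alpha<\beta$ such that $(r\cos\theta,r\sin\theta)\in\partial\Omega_\lambda$ for all $\theta\in(\alpha,\beta)$. -/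

import Mathlib

open MeasureTheory

noncomputable section

namespace AnnulusProblem

/-- The Euclidean plane `ℝ²`. -/
abbrev Plane : Type := EuclideanSpace ℝ (Fin 2)

/-- The disk `D_r` of radius `r` centred at the origin. -/
def disk (r : ℝ) : Set Plane := Metric.closedBall 0 r

/-- The class of convex sets `K` of the plane with `D_a ⊆ K ⊆ D_b`. -/
def convexClass (a b : ℝ) : Set (Set Plane) :=
  {K | Convex ℝ K ∧ disk a ⊆ K ∧ K ⊆ disk b}

/-- The area of a plane set: its Lebesgue measure. -/
def area (K : Set Plane) : ℝ := (volume K).toReal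

/-- The perimeter of a plane convex set with non-empty interior: the length, that is, the
one-dimensional Hausdorff measure, of its boundary (which is finite if the set is bounded). -/
def perimeter (K : Set Plane) : ℝ := (Measure.hausdorffMeasure 1 (frontier K)).toReal

/-- The functional `J_l(K) = l |K| - P(K)`. -/
def functional (l : ℝ) (K : Set Plane) : ℝ := l * area K - perimeter K

/-- `K` solves the problem of minimizing `J_l` among the convex sets between `D_a` and `D_b`. -/
def IsMinimizer (a b l : ℝ) (K : Set Plane) : Prop :=
  K ∈ convexClass a b ∧ IsMinOn (functional l) (convexClass a b) K

/-- The open arc of the circle of radius `r` centred at the origin formed by the points with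
polar angle strictly between `α` and `β`. -/
def arc (r α β : ℝ) : Set Plane :=
  (fun θ : ℝ => (!₂[r * Real.cos θ, r * Real.sin θ] : Plane)) '' Set.Ioo α β

/-- The set `S` contains a non-degenerate arc of the boundary circle of `D_r`. -/
def ContainsArc (S : Set Plane) (r : ℝ) : Prop :=
  ∃ α β : ℝ, α < β ∧ arc r α β ⊆ S

end AnnulusProblem

end

noncomputable section

namespace AnnulusProblem

/-! Both halves are local perturbation arguments: an arc on either circle permits a competitor with
strictly smaller `functional`. By rotation invariance the arc may be centred at angle 0; let it
contain the angles in `[-ε, ε]`.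

On the outer circle, cut off the cap beyond the chord joining the angles `±ε`. The area drops by
`b²(ε - sin ε cos ε) ~ (2/3)b²ε³` and the perimeter by at most `2b(ε - sin ε) ~ bε³/3`, so the cut
pays off for small `ε` exactly when `l * b > 1/2` (`eventually_cap_inequality`).

On the inner circle, the tangents along the arc support `K`. Add the corner between the tangents at
`±ε`. The area grows by at most `a²(tan ε - ε)`, the perimeter by at least `2a(tan ε - ε)`, and `l *
a < 2` decides; `ε` need only be small enough for the corner to fit in `D_b`.

Perimeters are compared in `functional_lt_of_bounds` through the boundary part `R` common to `K` and
the competitor. Only an upper bound for the old boundary (an arc, as a Lipschitz image) and a lower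
bound for the new one (segments) are needed. -/

/-! ### Polar coordinates and length of arcs -/

/-- The point of the plane with polar coordinates `(r, θ)`. -/
def polarPoint (r θ : ℝ) : Plane := !₂[r * Real.cos θ, r * Real.sin θ]

@[simp] lemma polarPoint_zero (r θ : ℝ) : polarPoint r θ 0 = r * Real.cos θ := rfl

@[simp] lemma polarPoint_one (r θ : ℝ) : polarPoint r θ 1 = r * Real.sin θ := rfl

lemma plane_ext {x y : Plane} (h₀ : x 0 = y 0) (h₁ : x 1 = y 1) : x = y := by
  ext i
  fin_cases i
  exacts [h₀, h₁]

lemma norm_sq_eq_coord (x : Plane) : ‖x‖ ^ 2 = x 0 ^ 2 + x 1 ^ 2 := by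
  rw [EuclideanSpace.norm_sq_eq]
  simp [Fin.sum_univ_two]

lemma smul_polarPoint (t r θ : ℝ) : t • polarPoint r θ = polarPoint (t * r) θ :=
  plane_ext (by simp [mul_assoc]) (by simp [mul_assoc])

lemma norm_polarPoint {r : ℝ} (hr : 0 ≤ r) (θ : ℝ) : ‖polarPoint r θ‖ = r := by
  rw [← sq_eq_sq₀ (norm_nonneg _) hr, norm_sq_eq_coord, polarPoint_zero, polarPoint_one]
  linear_combination r ^ 2 * Real.sin_sq_add_cos_sq θ

lemma exists_polarPoint_eq (x : Plane) :
    ∃ θ ∈ Set.Ioc (-Real.pi) Real.pi, polarPoint ‖x‖ θ = x := by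
  have hn : ‖(⟨x 0, x 1⟩ : ℂ)‖ = ‖x‖ := by
    rw [← sq_eq_sq₀ (norm_nonneg _) (norm_nonneg _), norm_sq_eq_coord, Complex.sq_norm,
      Complex.normSq_apply]
    ring
  refine ⟨Complex.arg ⟨x 0, x 1⟩, Complex.arg_mem_Ioc _, plane_ext ?_ ?_⟩
  · rw [polarPoint_zero, ← hn, Complex.norm_mul_cos_arg]
  · rw [polarPoint_one, ← hn, Complex.norm_mul_sin_arg]

/-- The squared chord is `2r²(1 - cos(θ - φ))`, and `1 - x²/2 ≤ cos x`. -/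
lemma lipschitzWith_polarPoint (r : NNReal) : LipschitzWith r (polarPoint r) := by
  refine LipschitzWith.of_dist_le_mul fun θ φ => ?_
  rw [dist_eq_norm, Real.dist_eq]
  refine abs_le_of_sq_le_sq' ?_ (by positivity) |>.2
  rw [norm_sq_eq_coord, mul_pow, sq_abs]
  simp only [PiLp.sub_apply, polarPoint_zero, polarPoint_one]
  have h₁ := Real.one_sub_sq_div_two_le_cos (x := θ - φ)
  rw [Real.cos_sub] at h₁
  have h₂ : (0 : ℝ) ≤ (r : ℝ) ^ 2 := by positivity
  nlinarith [mul_le_mul_of_nonneg_left h₁ h₂, Real.sin_sq_add_cos_sq θ,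
    Real.sin_sq_add_cos_sq φ]

lemma hausdorffMeasure_image_polarPoint_le {r : ℝ} (hr : 0 ≤ r) (α β : ℝ) :
    Measure.hausdorffMeasure 1 (polarPoint r '' Set.Icc α β) ≤ ENNReal.ofReal (r * (β - α)) := by
  lift r to NNReal using hr
  refine ((lipschitzWith_polarPoint r).hausdorffMeasure_image_le zero_le_one _).trans ?_
  rw [hausdorffMeasure_real, Real.volume_Icc, ENNReal.rpow_one,
    ENNReal.ofReal_mul (NNReal.coe_nonneg r), ENNReal.ofReal_coe_nnreal]

/-! ### Finiteness of the perimeter -/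

/-- The boundary of a plane convex set between two disks has finite length. -/
lemma hausdorffMeasure_frontier_lt_top {a b : ℝ} (ha : 0 < a) (hab : a < b) {K : Set Plane}
    (hK : K ∈ convexClass a b) : Measure.hausdorffMeasure 1 (frontier K) < ⊤ := by
  obtain ⟨hc, haK, hKb⟩ := hK
  have hb : 0 < b := ha.trans hab
  have h₀ : K ∈ nhds (0 : Plane) := Filter.mem_of_superset (Metric.closedBall_mem_nhds 0 ha) haK
  -- `K ⊆ D_b` keeps the gauge away from zero on the unit circle and `D_a ⊆ K` makes it Lipschitz.
  -- Hence its reciprocal, the radial function, is Lipschitz, and the boundary lies in a Lipschitz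
  -- image of `[-π, π]`.
  have hlow : ∀ x : Plane, ‖x‖ / b ≤ gauge K x := fun x => by
    rw [← gauge_closedBall hb.le]
    exact gauge_mono (absorbent_nhds_zero h₀) hKb x
  lift a to NNReal using ha.le
  have hL : LipschitzWith a⁻¹ (gauge K) := by
    refine hc.lipschitzWith_gauge (by exact_mod_cast ha) (Metric.ball_subset_closedBall.trans haK)
  set g : ℝ → ℝ := fun θ => gauge K (polarPoint 1 θ) with hg
  have hP : LipschitzWith 1 (polarPoint 1) := lipschitzWith_polarPoint 1
  have hgL : LipschitzWith a⁻¹ g := by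
    have h := hL.comp hP
    rw [mul_one] at h
    exact h
  have hg_low : ∀ θ, b⁻¹ ≤ g θ := fun θ => by
    simpa [norm_polarPoint zero_le_one, one_div] using hlow (polarPoint 1 θ)
  have hg_pos : ∀ θ, 0 < g θ := fun θ => (inv_pos.2 hb).trans_le (hg_low θ)
  have hinv_le : ∀ θ, (g θ)⁻¹ ≤ b := fun θ => inv_le_of_inv_le₀ hb (hg_low θ)
  have hF : LipschitzWith (Real.toNNReal (b + b * b * (a : ℝ)⁻¹))
      (fun θ => (g θ)⁻¹ • polarPoint 1 θ) := by
    refine LipschitzWith.of_dist_le_mul fun θ φ => ?_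
    rw [Real.coe_toNNReal _ (by positivity), dist_eq_norm]
    have e : (g θ)⁻¹ • polarPoint 1 θ - (g φ)⁻¹ • polarPoint 1 φ =
        (g θ)⁻¹ • (polarPoint 1 θ - polarPoint 1 φ) +
          ((g θ)⁻¹ - (g φ)⁻¹) • polarPoint 1 φ := by
      rw [smul_sub, sub_smul]; abel
    rw [e]
    refine (norm_add_le _ _).trans ?_
    rw [norm_smul, norm_smul, norm_polarPoint zero_le_one, mul_one, Real.norm_eq_abs,
      Real.norm_eq_abs, abs_of_pos (inv_pos.2 (hg_pos θ)), ← dist_eq_norm]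
    have h₁ := hP.dist_le_mul θ φ
    have h₂ := hgL.dist_le_mul φ θ
    rw [NNReal.coe_one, one_mul] at h₁
    rw [NNReal.coe_inv, Real.dist_eq, dist_comm] at h₂
    have h₃ : |(g θ)⁻¹ - (g φ)⁻¹| = (g θ)⁻¹ * (g φ)⁻¹ * |g φ - g θ| := by
      rw [inv_sub_inv (hg_pos θ).ne' (hg_pos φ).ne', abs_div, abs_mul, abs_of_pos (hg_pos θ),
        abs_of_pos (hg_pos φ)]
      have := (hg_pos θ).ne'
      have := (hg_pos φ).ne'
      field_simp
    rw [h₃, add_mul]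
    have p₁ := (inv_pos.2 (hg_pos θ)).le
    have p₂ := (inv_pos.2 (hg_pos φ)).le
    refine add_le_add (mul_le_mul (hinv_le θ) h₁ dist_nonneg hb.le) ?_
    rw [mul_assoc (b * b)]
    exact mul_le_mul (mul_le_mul (hinv_le θ) (hinv_le φ) p₂ hb.le) h₂ (abs_nonneg _)
      (by positivity)
  have hsub : frontier K ⊆ (fun θ => (g θ)⁻¹ • polarPoint 1 θ) '' Set.Icc (-Real.pi) Real.pi := by
    intro x hx
    obtain ⟨θ, hθ, hxθ⟩ := exists_polarPoint_eq x
    refine ⟨θ, Set.Ioc_subset_Icc_self hθ, ?_⟩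
    have h1 := (gauge_eq_one_iff_mem_frontier hc h₀).2 hx
    have e : x = ‖x‖ • polarPoint 1 θ := by rw [smul_polarPoint, mul_one, hxθ]
    rw [e, gauge_smul_of_nonneg (norm_nonneg _), smul_eq_mul] at h1
    have : (g θ)⁻¹ = ‖x‖ := (eq_inv_of_mul_eq_one_left h1).symm
    simp only [this]
    exact e.symm
  refine (measure_mono hsub).trans_lt ((hF.hausdorffMeasure_image_le zero_le_one _).trans_lt ?_)
  rw [hausdorffMeasure_real, Real.volume_Icc, ENNReal.rpow_one]
  exact ENNReal.mul_lt_top ENNReal.coe_lt_top ENNReal.ofReal_lt_top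

/-! ### Areas in polar coordinates -/

/-- The points with polar angle in `[α, β]` and radius between `ρ₁` and `ρ₂`. -/
def polarRegion (α β : ℝ) (ρ₁ ρ₂ : ℝ → ℝ) : Set Plane :=
  {x | ∃ r θ, θ ∈ Set.Icc α β ∧ r ∈ Set.Ioc (ρ₁ θ) (ρ₂ θ) ∧ polarPoint r θ = x}

lemma lintegral_Ioc_ofReal_id {u v : ℝ} (hu : 0 ≤ u) (huv : u ≤ v) :
    ∫⁻ r in Set.Ioc u v, ENNReal.ofReal r = ENNReal.ofReal ((v ^ 2 - u ^ 2) / 2) := by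
  rw [← ofReal_integral_eq_lintegral_ofReal, ← intervalIntegral.integral_of_le huv, integral_id]
  · exact (continuous_id.integrableOn_Icc).mono_set Set.Ioc_subset_Icc_self
  · exact (ae_restrict_iff' measurableSet_Ioc).2 (.of_forall fun r hr => hu.trans hr.1.le)

/-- The area of a region given in polar coordinates. -/
lemma volume_polarRegion {α β : ℝ} (hα : -Real.pi < α) (hβ : β < Real.pi) (hαβ : α ≤ β)
    {ρ₁ ρ₂ F : ℝ → ℝ} (hm₁ : Measurable ρ₁) (hm₂ : Measurable ρ₂)
    (h₁ : ∀ θ ∈ Set.Icc α β, 0 ≤ ρ₁ θ) (h₂ : ∀ θ ∈ Set.Icc α β, ρ₁ θ ≤ ρ₂ θ)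
    (hF : ∀ θ ∈ Set.Icc α β, HasDerivAt F ((ρ₂ θ ^ 2 - ρ₁ θ ^ 2) / 2) θ) :
    volume (polarRegion α β ρ₁ ρ₂) = ENNReal.ofReal (F β - F α) := by
  set A : Set (ℝ × ℝ) := {p | p.2 ∈ Set.Icc α β ∧ p.1 ∈ Set.Ioc (ρ₁ p.2) (ρ₂ p.2)} with hA
  have hAm : MeasurableSet A := by
    refine (measurable_snd measurableSet_Icc).inter
      ((measurableSet_lt (hm₁.comp measurable_snd) measurable_fst).inter
        (measurableSet_le measurable_fst (hm₂.comp measurable_snd)))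
  have hAt : A ⊆ polarCoord.target := fun p hp =>
    ⟨(h₁ _ hp.1).trans_lt hp.2.1, hα.trans_le hp.1.1, hp.1.2.trans_lt hβ⟩
  set e : Plane ≃ᵐ ℝ × ℝ :=
    (MeasurableEquiv.toLp 2 (Fin 2 → ℝ)).symm.trans MeasurableEquiv.finTwoArrow with he
  have hmp : MeasurePreserving e volume volume :=
    (volume_preserving_finTwoArrow ℝ).comp
      (EuclideanSpace.volume_preserving_symm_measurableEquiv_toLp (Fin 2))
  have hpre : polarRegion α β ρ₁ ρ₂ = e ⁻¹' (polarCoord.symm '' A) := by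
    ext x
    constructor
    · rintro ⟨r, θ, hθ, hr, rfl⟩
      exact ⟨(r, θ), ⟨hθ, hr⟩, rfl⟩
    · rintro ⟨⟨r, θ⟩, ⟨hθ, hr⟩, hx⟩
      refine ⟨r, θ, hθ, hr, e.injective ?_⟩
      exact hx
  have hnn : ∀ θ ∈ Set.Icc α β, 0 ≤ (ρ₂ θ ^ 2 - ρ₁ θ ^ 2) / 2 := fun θ hθ => by
    nlinarith [h₁ θ hθ, h₂ θ hθ]
  rw [hpre, hmp.measure_preimage_equiv, ← lintegral_abs_det_fderiv_eq_addHaar_image volume hAm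
    (fun p _ => (hasFDerivAt_polarCoord_symm p).hasFDerivWithinAt) (polarCoord.symm.injOn.mono hAt)]
  simp only [det_fderivPolarCoordSymm]
  rw [← lintegral_indicator hAm, Measure.volume_eq_prod,
    lintegral_prod_symm' _ ((by fun_prop : Measurable fun p : ℝ × ℝ =>
      ENNReal.ofReal |p.1|).indicator hAm)]
  have hinner : ∀ θ, ∫⁻ r, A.indicator (fun p : ℝ × ℝ => ENNReal.ofReal |p.1|) (r, θ) =
      (Set.Icc α β).indicator (fun θ => ENNReal.ofReal ((ρ₂ θ ^ 2 - ρ₁ θ ^ 2) / 2)) θ := by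
    intro θ
    by_cases hθ : θ ∈ Set.Icc α β
    · rw [Set.indicator_of_mem hθ, ← lintegral_Ioc_ofReal_id (h₁ θ hθ) (h₂ θ hθ),
        ← lintegral_indicator measurableSet_Ioc]
      refine lintegral_congr fun r => ?_
      by_cases hr : r ∈ Set.Ioc (ρ₁ θ) (ρ₂ θ)
      · rw [Set.indicator_of_mem hr, Set.indicator_of_mem (show (r, θ) ∈ A from ⟨hθ, hr⟩),
          abs_of_pos ((h₁ θ hθ).trans_lt hr.1)]
      · rw [Set.indicator_of_notMem hr, Set.indicator_of_notMem fun h => hr h.2]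
    · rw [Set.indicator_of_notMem hθ]
      refine (lintegral_congr fun r => ?_).trans lintegral_zero
      exact Set.indicator_of_notMem (fun h => hθ h.1) _
  simp only [hinner]
  -- The radii are only assumed measurable; integrability comes from the nonnegativity of the
  -- derivative of `F`.
  have hint : IntervalIntegrable (fun θ => (ρ₂ θ ^ 2 - ρ₁ θ ^ 2) / 2) volume α β := by
    rw [intervalIntegrable_iff_integrableOn_Ioc_of_le hαβ]
    refine intervalIntegral.integrableOn_deriv_of_nonneg (g := F) ?_ ?_ ?_
    · exact fun θ hθ => (hF θ hθ).continuousAt.continuousWithinAt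
    · exact fun θ hθ => hF θ (Set.Ioo_subset_Icc_self hθ)
    · exact fun θ hθ => hnn θ (Set.Ioo_subset_Icc_self hθ)
  rw [lintegral_indicator measurableSet_Icc, ← intervalIntegral.integral_eq_sub_of_hasDerivAt
    (by rwa [Set.uIcc_of_le hαβ]) hint, intervalIntegral.integral_of_le hαβ,
    ← integral_Icc_eq_integral_Ioc, ofReal_integral_eq_lintegral_ofReal]
  · refine (integrableOn_Icc_iff_integrableOn_Ioc (by finiteness)).2 ?_
    exact (intervalIntegrable_iff_integrableOn_Ioc_of_le hαβ).1 hint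
  · exact (ae_restrict_iff' measurableSet_Icc).2 (.of_forall hnn)

/-! ### Rotation invariance -/

/-- The rotation of the plane by the angle `φ`. -/
def planeRotation (φ : ℝ) : Plane ≃ₗᵢ[ℝ] Plane :=
  LinearIsometry.toLinearIsometryEquiv
    { toFun := fun x => !₂[Real.cos φ * x 0 - Real.sin φ * x 1, Real.sin φ * x 0 + Real.cos φ * x 1]
      map_add' := fun x y => plane_ext
        (by simp; ring) (by simp; ring)
      map_smul' := fun t x => plane_ext
        (by simp; ring) (by simp; ring)
      norm_map' := fun x => by
        rw [← sq_eq_sq₀ (norm_nonneg _) (norm_nonneg _), norm_sq_eq_coord, norm_sq_eq_coord]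
        simp
        linear_combination (x 0 ^ 2 + x 1 ^ 2) * Real.sin_sq_add_cos_sq φ } rfl

lemma planeRotation_polarPoint (φ r θ : ℝ) :
    planeRotation φ (polarPoint r θ) = polarPoint r (φ + θ) := by
  refine plane_ext ?_ ?_
  · rw [polarPoint_zero, Real.cos_add]
    change Real.cos φ * (r * Real.cos θ) - Real.sin φ * (r * Real.sin θ) = _
    ring
  · rw [polarPoint_one, Real.sin_add]
    change Real.sin φ * (r * Real.cos θ) + Real.cos φ * (r * Real.sin θ) = _
    ring

lemma functional_image (e : Plane ≃ₗᵢ[ℝ] Plane) (l : ℝ) (K : Set Plane) :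
    functional l (e '' K) = functional l K := by
  have h₁ : volume (e '' K) = volume K := by
    rw [LinearIsometryEquiv.image_eq_preimage_symm]
    exact e.symm.measurePreserving.measure_preimage_equiv (f := e.symm.toMeasurableEquiv) K
  have h₂ : frontier (e '' K) = e '' frontier K := (e.toHomeomorph.image_frontier K).symm
  have h₃ := e.toIsometryEquiv.hausdorffMeasure_image 1 (frontier K)
  rw [functional, functional, area, area, perimeter, perimeter, h₁, h₂]
  rw [LinearIsometryEquiv.coe_toIsometryEquiv] at h₃
  rw [h₃]

lemma image_mem_convexClass (e : Plane ≃ₗᵢ[ℝ] Plane) {a b : ℝ} {K : Set Plane}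
    (hK : K ∈ convexClass a b) : e '' K ∈ convexClass a b := by
  have hd : ∀ r, e '' disk r = disk r := fun r => by
    rw [disk, e.image_closedBall, map_zero]
  refine ⟨hK.1.linear_image e.toLinearEquiv.toLinearMap, ?_, ?_⟩
  · rw [← hd a]; exact Set.image_mono hK.2.1
  · rw [← hd b]; exact Set.image_mono hK.2.2

lemma IsMinimizer.image (e : Plane ≃ₗᵢ[ℝ] Plane) {a b l : ℝ} {K : Set Plane}
    (hK : IsMinimizer a b l K) : IsMinimizer a b l (e '' K) := by
  refine ⟨image_mem_convexClass e hK.1, fun L hL => ?_⟩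
  have := hK.2 (image_mem_convexClass e.symm hL)
  simpa [functional_image] using this

/-- A minimizer whose boundary contains an arc can be rotated so that the arc is centred at
the polar angle `0`. -/
lemma exists_isMinimizer_of_containsArc {a b l r : ℝ} {K : Set Plane}
    (hK : IsMinimizer a b l K) (h : ContainsArc (frontier K) r) :
    ∃ L, IsMinimizer a b l L ∧ ∃ δ > 0, ∀ θ, |θ| < δ → polarPoint r θ ∈ frontier L := by
  obtain ⟨α, β, hαβ, harc⟩ := h
  set e := planeRotation (-((α + β) / 2)) with he
  refine ⟨e '' K, hK.image e, (β - α) / 2, by linarith, fun θ hθ => ?_⟩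
  have h₂ : frontier (e '' K) = e '' frontier K := (e.toHomeomorph.image_frontier K).symm
  rw [abs_lt] at hθ
  rw [h₂]
  refine ⟨polarPoint r (θ + (α + β) / 2), harc ⟨_, ⟨?_, ?_⟩, rfl⟩, ?_⟩
  · linarith
  · linarith
  · rw [he, planeRotation_polarPoint]
    congr 1
    ring

/-! ### Comparison of functionals, heights and interior points -/

/-- Comparison of `J_l` for two sets with finite perimeter. -/
lemma functional_lt_of_bounds {a b l : ℝ} (ha : 0 < a) (hab : a < b) {K L R : Set Plane}
    (hK : K ∈ convexClass a b) (hL : L ∈ convexClass a b) {p q d : ℝ} (hp : 0 ≤ p) (hq : 0 ≤ q)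
    (hRK : R ⊆ frontier K)
    (hPK : Measure.hausdorffMeasure 1 (frontier K) ≤
      Measure.hausdorffMeasure 1 R + ENNReal.ofReal p)
    (hPL : Measure.hausdorffMeasure 1 R + ENNReal.ofReal q ≤
      Measure.hausdorffMeasure 1 (frontier L))
    (hA : l * (area L - area K) ≤ d) (hd : d < q - p) : functional l L < functional l K := by
  -- `toReal` sends `⊤` to 0, so finiteness is essential here; it also lets the measure of `R`
  -- cancel.
  have fK := (hausdorffMeasure_frontier_lt_top ha hab hK).ne
  have fL := (hausdorffMeasure_frontier_lt_top ha hab hL).ne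
  have fR := ne_top_of_le_ne_top fK (measure_mono hRK)
  have h₁ := ENNReal.toReal_mono (by finiteness) hPK
  have h₂ := ENNReal.toReal_mono fL hPL
  rw [ENNReal.toReal_add fR ENNReal.ofReal_ne_top, ENNReal.toReal_ofReal hp] at h₁
  rw [ENNReal.toReal_add fR ENNReal.ofReal_ne_top, ENNReal.toReal_ofReal hq] at h₂
  rw [functional, functional, perimeter, perimeter]
  linarith

lemma volume_ne_top_of_mem_convexClass {a b : ℝ} {K : Set Plane} (hK : K ∈ convexClass a b) :
    volume K ≠ ⊤ :=
  ((measure_mono hK.2.2).trans_lt measure_closedBall_lt_top).ne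

lemma zero_mem_interior_of_mem_convexClass {a b : ℝ} (ha : 0 < a) {K : Set Plane}
    (hK : K ∈ convexClass a b) : (0 : Plane) ∈ interior K :=
  mem_interior_iff_mem_nhds.2
    (Filter.mem_of_superset (Metric.closedBall_mem_nhds 0 ha) hK.2.1)

/-- The linear functional `x ↦ x · (cos φ, sin φ)`. -/
def height (φ : ℝ) : Plane →L[ℝ] ℝ :=
  Real.cos φ • EuclideanSpace.proj 0 + Real.sin φ • EuclideanSpace.proj 1

lemma height_apply (φ : ℝ) (x : Plane) : height φ x = Real.cos φ * x 0 + Real.sin φ * x 1 := by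
  simp [height]

lemma height_zero (x : Plane) : height 0 x = x 0 := by simp [height_apply]

lemma height_polarPoint (φ r θ : ℝ) : height φ (polarPoint r θ) = r * Real.cos (θ - φ) := by
  rw [height_apply, polarPoint_zero, polarPoint_one, Real.cos_sub]
  ring

/-- A point where `height φ` is maximal on `K` is not interior to `K`. -/
lemma notMem_interior_of_forall_height_le {K : Set Plane} {x : Plane} {φ : ℝ}
    (h : ∀ y ∈ K, height φ y ≤ height φ x) : x ∉ interior K := by
  intro hx
  have ht : Filter.Tendsto (fun s : ℝ => x + s • polarPoint 1 φ) (nhdsWithin 0 (Set.Ioi 0))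
      (nhds x) := by
    have : Continuous fun s : ℝ => x + s • polarPoint 1 φ := by fun_prop
    simpa using (this.tendsto 0).mono_left nhdsWithin_le_nhds
  obtain ⟨s, hs, hs₀⟩ := ((ht.eventually (mem_interior_iff_mem_nhds.1 hx)).and
    self_mem_nhdsWithin).exists
  have := h _ hs
  rw [map_add, map_smul, height_polarPoint, sub_self, Real.cos_zero, smul_eq_mul] at this
  have hs₀ : 0 < s := hs₀
  linarith

lemma smul_mem_interior {K : Set Plane} (hK : Convex ℝ K) (h₀ : (0 : Plane) ∈ interior K)
    {x : Plane} (hx : x ∈ closure K) {t : ℝ} (ht₀ : 0 ≤ t) (ht : t < 1) : t • x ∈ interior K := by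
  have := hK.combo_interior_closure_mem_interior h₀ hx (sub_pos.2 ht) ht₀ (by ring)
  simpa using this

lemma abs_le_of_cos_le_cos {ε θ : ℝ} (hε₀ : 0 ≤ ε) (hθ : θ ∈ Set.Ioc (-Real.pi) Real.pi)
    (h : Real.cos ε ≤ Real.cos θ) : |θ| ≤ ε := by
  by_contra! hlt
  have := Real.cos_lt_cos_of_nonneg_of_le_pi hε₀ (abs_le.2 ⟨hθ.1.le, hθ.2⟩) hlt
  rw [Real.cos_abs] at this
  linarith

/-! ### Outer circle: cutting off a cap -/

/-- The difference of the two sides vanishes at 0 and has derivative `2(1 - cos x)(m(1 + cos x) -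
1)`, positive for small `x > 0` because `2m > 1`. -/
lemma eventually_cap_inequality {m : ℝ} (hm : 1 / 2 < m) :
    ∀ᶠ ε in nhdsWithin (0 : ℝ) (Set.Ioi 0),
      2 * (ε - Real.sin ε) < m * (ε - Real.sin ε * Real.cos ε) := by
  have hcont : ContinuousAt (fun x : ℝ => m * (1 + Real.cos x) - 1) 0 := by fun_prop
  have hev : ∀ᶠ x in nhds (0 : ℝ), 0 < m * (1 + Real.cos x) - 1 :=
    hcont.eventually (lt_mem_nhds (by simp only [Real.cos_zero]; linarith))
  obtain ⟨η, hη, hball⟩ := Metric.eventually_nhds_iff.1 hev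
  filter_upwards [Ioo_mem_nhdsGT (lt_min hη Real.pi_pos)] with ε hε
  have hεη := hε.2.trans_le (min_le_left _ _)
  have hεπ := hε.2.trans_le (min_le_right _ _)
  set f : ℝ → ℝ := fun x => m * (x - Real.sin x * Real.cos x) - 2 * (x - Real.sin x) with hf
  have hd : ∀ x, HasDerivAt f (2 * (1 - Real.cos x) * (m * (1 + Real.cos x) - 1)) x := fun x => by
    have h := (((hasDerivAt_id x).sub ((Real.hasDerivAt_sin x).mul
      (Real.hasDerivAt_cos x))).const_mul m).sub
        (((hasDerivAt_id x).sub (Real.hasDerivAt_sin x)).const_mul 2)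
    refine h.congr_deriv ?_
    linear_combination m * Real.sin_sq_add_cos_sq x
  have hmono : StrictMonoOn f (Set.Icc 0 ε) := by
    refine strictMonoOn_of_deriv_pos (convex_Icc 0 ε)
      (fun x _ => (hd x).continuousAt.continuousWithinAt) fun x hx => ?_
    rw [interior_Icc] at hx
    rw [(hd x).deriv]
    have h₁ : Real.cos x < 1 := by
      have := Real.cos_lt_cos_of_nonneg_of_le_pi le_rfl (hx.2.trans hεπ).le hx.1
      rwa [Real.cos_zero] at this
    have h₂ := hball (y := x) (by
      rw [dist_zero_right, Real.norm_eq_abs, abs_of_pos hx.1]; exact hx.2.trans hεη)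
    exact mul_pos (by linarith) h₂
  have := hmono (Set.left_mem_Icc.2 hε.1.le) (Set.right_mem_Icc.2 hε.1.le) hε.1
  simp only [hf, Real.sin_zero] at this
  linarith

/-- The area of the circular segment of half opening angle `ε` of the disk of radius `b`. -/
lemma volume_cap {b ε : ℝ} (hb : 0 < b) (hε : 0 < ε) (hε' : ε < Real.pi / 2) :
    volume (polarRegion (-ε) ε (fun θ => b * Real.cos ε / Real.cos θ) fun _ => b) =
      ENNReal.ofReal (b ^ 2 * (ε - Real.sin ε * Real.cos ε)) := by
  have hcε : 0 < Real.cos ε := Real.cos_pos_of_mem_Ioo ⟨by linarith, hε'⟩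
  have hcos : ∀ θ ∈ Set.Icc (-ε) ε, 0 < Real.cos θ := fun θ hθ =>
    Real.cos_pos_of_mem_Ioo ⟨by linarith [hθ.1], by linarith [hθ.2]⟩
  have hpi := Real.pi_pos
  rw [volume_polarRegion (F := fun θ => (b ^ 2 * θ - (b * Real.cos ε) ^ 2 * Real.tan θ) / 2)
    (by linarith) (by linarith) (by linarith) (by fun_prop) (by fun_prop)]
  · congr 1
    rw [Real.tan_neg, Real.tan_eq_sin_div_cos]
    field_simp
    ring
  · exact fun θ hθ => div_nonneg (by positivity) (hcos θ hθ).le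
  · intro θ hθ
    rw [div_le_iff₀ (hcos θ hθ)]
    refine mul_le_mul_of_nonneg_left ?_ hb.le
    rw [← Real.cos_abs θ]
    exact Real.cos_le_cos_of_nonneg_of_le_pi (abs_nonneg _) (by linarith) (abs_le.2 hθ)
  · intro θ hθ
    have h := (((hasDerivAt_id θ).const_mul (b ^ 2)).sub
      ((Real.hasDerivAt_tan (hcos θ hθ).ne').const_mul ((b * Real.cos ε) ^ 2))).div_const 2
    refine h.congr_deriv ?_
    rw [div_pow]
    ring

/-- Cutting off a small cap shows that a minimizer has no arc of the outer circle. -/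
lemma IsMinimizer.not_outer_arc {a b l : ℝ} (ha : 0 < a) (hab : a < b) (hl : 1 / (2 * b) < l)
    {K : Set Plane} (hK : IsMinimizer a b l K) {δ : ℝ} (hδ : 0 < δ)
    (harc : ∀ θ, |θ| < δ → polarPoint b θ ∈ frontier K) : False := by
  obtain ⟨hKc, hmin⟩ := hK
  have hb : 0 < b := ha.trans hab
  have hconv : Convex ℝ K := hKc.1
  have h₀ := zero_mem_interior_of_mem_convexClass ha hKc
  have hlb : 1 / 2 < l * b := by
    rw [div_lt_iff₀ (by positivity)] at hl
    linarith
  -- This keeps the cutting line clear of `D_a`, so the truncated set is admissible.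
  have hcos_ev : ∀ᶠ ε in nhdsWithin (0 : ℝ) (Set.Ioi 0), a < b * Real.cos ε := by
    have : ContinuousAt (fun ε : ℝ => b * Real.cos ε) 0 := by fun_prop
    exact nhdsWithin_le_nhds (this.eventually (lt_mem_nhds (by simpa using hab)))
  obtain ⟨ε, ⟨hcap, haε⟩, hε, hεm⟩ := (((eventually_cap_inequality hlb).and hcos_ev).and
    (Ioo_mem_nhdsGT (lt_min hδ (half_pos Real.pi_pos)))).exists
  have hεδ := hεm.trans_le (min_le_left _ _)
  have hεπ := hεm.trans_le (min_le_right _ _)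
  have hpi := Real.pi_pos
  have hcε : 0 < Real.cos ε := Real.cos_pos_of_mem_Ioo ⟨by linarith, hεπ⟩
  have hsε : 0 < Real.sin ε := Real.sin_pos_of_pos_of_lt_pi hε (by linarith)
  have hsub : closure K ⊆ disk b := closure_minimal hKc.2.2 Metric.isClosed_closedBall
  have harc' : ∀ θ, |θ| ≤ ε → polarPoint b θ ∈ closure K := fun θ hθ =>
    frontier_subset_closure (harc θ (hθ.trans_lt hεδ))
  set c := b * Real.cos ε with hc
  set L : Set Plane := K ∩ {x | height 0 x ≤ c} with hL
  have hLc : L ∈ convexClass a b := by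
    refine ⟨hconv.inter (convex_halfSpace_le (height 0).isLinear c),
      fun x hx => ⟨hKc.2.1 hx, ?_⟩, fun x hx => hKc.2.2 hx.1⟩
    have hx' : ‖x‖ ≤ a := by simpa [disk] using hx
    have : |x 0| ≤ ‖x‖ := by simpa using PiLp.norm_apply_le x 0
    simp only [Set.mem_ofPred_eq, height_zero]
    linarith [le_abs_self (x 0)]
  have hU : IsOpen {x : Plane | height 0 x < c} := isOpen_lt (height 0).continuous continuous_const
  set R : Set Plane := frontier K ∩ {x | height 0 x < c} with hR
  have hPK : Measure.hausdorffMeasure 1 (frontier K) ≤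
      Measure.hausdorffMeasure 1 R + ENNReal.ofReal (b * (ε - -ε)) := by
    refine (measure_mono ?_).trans ((measure_union_le R (polarPoint b '' Set.Icc (-ε) ε)).trans
      (add_le_add_right (hausdorffMeasure_image_polarPoint_le hb.le _ _) _))
    intro x hx
    by_cases hxc : height 0 x < c
    · exact Or.inl ⟨hx, hxc⟩
    right
    -- Beyond the chord, a point of the closure has angle at most `ε` in absolute value. If its norm
    -- were below `b`, it would be a contraction of an arc point towards the interior point 0, hence
    -- interior; so it lies on the arc.
    rw [not_lt, height_zero] at hxc
    have hxb : ‖x‖ ≤ b := by simpa [disk] using hsub (frontier_subset_closure hx)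
    obtain ⟨θ, hθ, hxθ⟩ := exists_polarPoint_eq x
    have hx0 : x 0 = ‖x‖ * Real.cos θ := by rw [← polarPoint_zero, hxθ]
    have hcθ : 0 < Real.cos θ := by
      refine pos_of_mul_pos_right ?_ (norm_nonneg x)
      rw [← hx0]
      exact (mul_pos hb hcε).trans_le hxc
    have hle : b * Real.cos ε ≤ b * Real.cos θ := by
      rw [hx0] at hxc
      exact hxc.trans (mul_le_mul_of_nonneg_right hxb hcθ.le)
    have hθε := abs_le_of_cos_le_cos hε.le hθ (le_of_mul_le_mul_left hle hb)
    rcases hxb.lt_or_eq with hlt | heq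
    · exfalso
      have := smul_mem_interior hconv h₀ (harc' θ hθε) (t := ‖x‖ / b) (by positivity)
        ((div_lt_one hb).2 hlt)
      rw [smul_polarPoint, div_mul_cancel₀ _ hb.ne', hxθ] at this
      exact hx.2 this
    · exact ⟨θ, abs_le.1 hθε, by rw [← heq, hxθ]⟩
  have hchord : ∀ x ∈ segment ℝ (polarPoint b (-ε)) (polarPoint b ε), height 0 x = c := by
    rintro _ ⟨s, t, hs, ht, hst, rfl⟩
    simp only [map_add, map_smul, height_polarPoint, sub_zero, Real.cos_neg, smul_eq_mul]
    rw [← add_mul, hst, one_mul]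
  have hPL : Measure.hausdorffMeasure 1 R + ENNReal.ofReal (2 * b * Real.sin ε) ≤
      Measure.hausdorffMeasure 1 (frontier L) := by
    have hseg : Measure.hausdorffMeasure 1 (segment ℝ (polarPoint b (-ε)) (polarPoint b ε)) =
        ENNReal.ofReal (2 * b * Real.sin ε) := by
      rw [hausdorffMeasure_segment, edist_dist, dist_eq_norm]
      congr 1
      rw [← sq_eq_sq₀ (norm_nonneg _) (by positivity), norm_sq_eq_coord]
      simp
      ring
    rw [← hseg, ← measure_union]
    · refine measure_mono (Set.union_subset ?_ ?_)
      · have e : L ∩ {x | height 0 x < c} = K ∩ {x | height 0 x < c} := by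
          rw [hL, Set.inter_assoc]
          congr 1
          exact Set.inter_eq_right.2 fun x hx => le_of_lt (Set.mem_ofPred.1 hx)
        rw [hR, ← frontier_inter_open_inter hU, ← e, frontier_inter_open_inter hU]
        exact Set.inter_subset_left
      · intro x hx
        have hxc := hchord x hx
        have hxK : x ∈ closure K := hconv.closure.segment_subset
          (harc' _ (by rw [abs_neg, abs_of_pos hε])) (harc' _ (abs_of_pos hε).le) hx
        refine ⟨?_, notMem_interior_of_forall_height_le (φ := 0) fun y hy => hxc ▸ hy.2⟩
        -- `K` need not be closed, so the chord is approached by the points `t • x`, `t < 1`, which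
        -- are interior to `K` and on the kept side.
        have ht : Filter.Tendsto (fun t : ℝ => t • x) (nhdsWithin 1 (Set.Iio 1)) (nhds x) := by
          have : Continuous fun t : ℝ => t • x := by fun_prop
          simpa using (this.tendsto 1).mono_left nhdsWithin_le_nhds
        refine mem_closure_of_tendsto ht ?_
        filter_upwards [Ioo_mem_nhdsLT (zero_lt_one' ℝ)] with t ht
        refine ⟨interior_subset (smul_mem_interior hconv h₀ hxK ht.1.le ht.2), ?_⟩
        simp only [Set.mem_ofPred_eq, map_smul, hxc, smul_eq_mul]
        exact mul_le_of_le_one_left (by positivity) ht.2.le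
    · refine Set.disjoint_left.2 fun x hx hx' => ?_
      exact (lt_irrefl c) (hchord x hx' ▸ hx.2)
    · rw [segment_eq_image_lineMap]
      exact (isCompact_Icc.image AffineMap.lineMap_continuous).measurableSet
  have hvol : volume L + ENNReal.ofReal (b ^ 2 * (ε - Real.sin ε * Real.cos ε)) ≤ volume K := by
    -- The cap is only known to lie in `closure K`; the frontier of a convex set is null, so no area
    -- is lost.
    have hcl : volume (closure K) = volume K :=
      measure_closure_of_null_frontier (hconv.addHaar_frontier volume)
    rw [← volume_cap hb hε hεπ, ← hcl, ← measure_union₀' (hLc.1.nullMeasurableSet volume)]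
    · refine measure_mono (Set.union_subset (Set.inter_subset_left.trans subset_closure) ?_)
      rintro _ ⟨r, θ, hθ, hr, rfl⟩
      have hcθ : 0 < Real.cos θ :=
        Real.cos_pos_of_mem_Ioo ⟨by linarith [hθ.1], by linarith [hθ.2]⟩
      have hr₀ : 0 < r := lt_of_le_of_lt (by positivity) hr.1
      have hmem := hconv.closure.smul_mem_of_zero_mem
        (subset_closure (interior_subset h₀)) (harc' θ (abs_le.2 hθ))
        (t := r / b) ⟨by positivity, (div_le_one hb).2 hr.2⟩
      rwa [smul_polarPoint, div_mul_cancel₀ _ hb.ne'] at hmem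
    · refine Disjoint.aedisjoint (Set.disjoint_left.2 ?_)
      rintro _ hx ⟨r, θ, hθ, hr, rfl⟩
      have hcθ : 0 < Real.cos θ :=
        Real.cos_pos_of_mem_Ioo ⟨by linarith [hθ.1], by linarith [hθ.2]⟩
      have h₁ := hr.1
      have h₂ : height 0 (polarPoint r θ) ≤ c := hx.2
      rw [height_polarPoint, sub_zero] at h₂
      rw [div_lt_iff₀ hcθ] at h₁
      linarith
  have hv₀ : 0 ≤ b ^ 2 * (ε - Real.sin ε * Real.cos ε) := by
    have := Real.sin_lt hε
    have := Real.cos_le_one ε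
    have : Real.sin ε * Real.cos ε ≤ Real.sin ε := mul_le_of_le_one_right hsε.le this
    exact mul_nonneg (by positivity) (by linarith)
  have harea := ENNReal.toReal_mono (volume_ne_top_of_mem_convexClass hKc) hvol
  rw [ENNReal.toReal_add (volume_ne_top_of_mem_convexClass hLc) ENNReal.ofReal_ne_top,
    ENNReal.toReal_ofReal hv₀] at harea
  have hl₀ : 0 < l := lt_trans (by positivity) hl
  refine absurd (hmin hLc) (not_le.2 (functional_lt_of_bounds ha hab hKc hLc (R := R)
    (d := -(l * (b ^ 2 * (ε - Real.sin ε * Real.cos ε)))) (by nlinarith) (by positivity)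
    Set.inter_subset_left hPK hPL ?_ ?_))
  · rw [← mul_neg]
    refine mul_le_mul_of_nonneg_left ?_ hl₀.le
    rw [area, area]
    linarith
  · nlinarith [mul_lt_mul_of_pos_left hcap hb]

/-! ### Inner circle: adding a corner -/

/-- Adding to a convex subset `K` of the convex set `W` the part of `W` on one side of a line whose
intersection with `W` lies in `K` gives a convex set. -/
lemma convex_union_inter_halfSpace {E : Type*} [AddCommGroup E] [Module ℝ E] {K W : Set E}
    (hK : Convex ℝ K) (hW : Convex ℝ W) (hKW : K ⊆ W) (f : E →ₗ[ℝ] ℝ) (c : ℝ)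
    (h : W ∩ {x | f x = c} ⊆ K) : Convex ℝ (K ∪ W ∩ {x | c ≤ f x}) := by
  have hT : Convex ℝ (W ∩ {x | c ≤ f x}) := hW.inter (convex_halfSpace_ge f.isLinear c)
  have key : ∀ x ∈ K, ∀ y ∈ W ∩ {x | c ≤ f x}, segment ℝ x y ⊆ K ∪ W ∩ {x | c ≤ f x} := by
    rintro x hx y ⟨hyW, hy⟩ z hz
    have hzW : z ∈ W := hW.segment_subset (hKW hx) hyW hz
    by_cases hzc : c ≤ f z
    · exact Or.inr ⟨hzW, hzc⟩
    left
    rw [not_le] at hzc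
    obtain ⟨s, t, hs, ht, hst, rfl⟩ := hz
    obtain rfl : s = 1 - t := by linarith
    have hy : c ≤ f y := hy
    simp only [map_add, map_smul, smul_eq_mul] at hzc
    have hfx : f x < c := by nlinarith
    have hd : 0 < f y - f x := by linarith
    -- The parameter where the segment from `x` to `y` crosses the line. The crossing point is in
    -- `K`, and `z` lies between it and `x`.
    set u := (c - f x) / (f y - f x) with hu
    have hu₀ : 0 < u := div_pos (by linarith) hd
    have hu₁ : u ≤ 1 := (div_le_one hd).2 (by linarith)
    have huc : u * (f y - f x) = c - f x := div_mul_cancel₀ _ hd.ne'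
    have hw : (1 - u) • x + u • y ∈ K := by
      refine h ⟨hW (hKW hx) hyW (by linarith) hu₀.le (by ring), ?_⟩
      simp only [Set.mem_ofPred_eq, map_add, map_smul, smul_eq_mul]
      linarith
    have htu : t ≤ u := by
      rw [hu, le_div_iff₀ hd]
      linarith
    have := hK hx hw (a := 1 - t / u) (b := t / u) (sub_nonneg.2 ((div_le_one hu₀).2 htu))
      (by positivity) (by ring)
    convert this using 1
    rw [smul_add, smul_smul, smul_smul, ← add_assoc, ← add_smul, mul_sub,
      div_mul_cancel₀ _ hu₀.ne']
    congr 2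
    ring
  rw [convex_iff_segment_subset]
  rintro x (hx | hx) y (hy | hy)
  · exact (hK.segment_subset hx hy).trans Set.subset_union_left
  · exact key x hx y hy
  · rw [segment_symm]
    exact key y hy x hx
  · exact (hT.segment_subset hx hy).trans Set.subset_union_right

/-- At a boundary point on the inscribed circle, the tangent to the circle supports the set. -/
lemma height_le_of_polarPoint_mem_frontier {a : ℝ} (ha : 0 < a) {K : Set Plane}
    (hK : Convex ℝ K) (haK : disk a ⊆ K) {θ : ℝ} (hθ : polarPoint a θ ∈ frontier K) {x : Plane}
    (hx : x ∈ closure K) : height θ x ≤ a := by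
  by_contra! hlt
  set y := polarPoint a θ with hy
  have hxy : x - y ≠ 0 := by
    intro h
    rw [sub_eq_zero.1 h, hy, height_polarPoint, sub_self, Real.cos_zero, mul_one] at hlt
    exact lt_irrefl _ hlt
  have hN : 0 < ‖x - y‖ ^ 2 := by positivity
  set d := height θ x - a with hd
  have hd₀ : 0 < d := sub_pos.2 hlt
  -- This `t` minimizes `‖y - t • (x - y)‖² = a² - 2tad + t²‖x - y‖²`. The resulting point is in the
  -- open disk, and `y`, lying strictly between it and `x`, would be interior to `K`.
  set t := a * d / ‖x - y‖ ^ 2 with ht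
  have ht₀ : 0 < t := by positivity
  have htN : t * ‖x - y‖ ^ 2 = a * d := div_mul_cancel₀ _ hN.ne'
  have hw : ‖y - t • (x - y)‖ < a := by
    refine lt_of_pow_lt_pow_left₀ 2 ha.le ?_
    have e : ‖y - t • (x - y)‖ ^ 2 = a ^ 2 - 2 * t * (a * d) + t * (t * ‖x - y‖ ^ 2) := by
      rw [norm_sq_eq_coord, norm_sq_eq_coord, hd, height_apply]
      simp only [PiLp.sub_apply, PiLp.smul_apply, smul_eq_mul, hy, polarPoint_zero, polarPoint_one]
      linear_combination (a ^ 2 + 2 * t * a ^ 2) * Real.sin_sq_add_cos_sq θ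
    rw [e, htN]
    nlinarith [mul_pos ht₀ (mul_pos ha hd₀)]
  have hwK : y - t • (x - y) ∈ interior K :=
    interior_mono haK (Metric.ball_subset_interior_closedBall (by simpa using hw))
  refine hθ.2 (hK.openSegment_interior_closure_subset_interior hwK hx
    ⟨1 / (1 + t), t / (1 + t), by positivity, by positivity, by field_simp, ?_⟩)
  have h1 : (1 + t) ≠ 0 := by positivity
  refine plane_ext ?_ ?_ <;>
  · simp only [PiLp.add_apply, PiLp.sub_apply, PiLp.smul_apply, smul_eq_mul]
    field_simp
    ring

/-- The wedge bounded by the tangents of the circle of radius `a` at the polar angles `±ε`. -/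
def wedge (a ε : ℝ) : Set Plane := {x | height ε x ≤ a} ∩ {x | height (-ε) x ≤ a}

/-- The triangle cut from the wedge by the chord between the points of tangency. -/
def tip (a ε : ℝ) : Set Plane := wedge a ε ∩ {x | a * Real.cos ε ≤ height 0 x}

lemma convex_wedge (a ε : ℝ) : Convex ℝ (wedge a ε) :=
  (convex_halfSpace_le (height ε).isLinear a).inter (convex_halfSpace_le (height (-ε)).isLinear a)

lemma convex_tip (a ε : ℝ) : Convex ℝ (tip a ε) :=
  (convex_wedge a ε).inter (convex_halfSpace_ge (height 0).isLinear _)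

lemma mem_wedge_iff {a ε : ℝ} {x : Plane} : x ∈ wedge a ε ↔
    Real.cos ε * x 0 + Real.sin ε * x 1 ≤ a ∧ Real.cos ε * x 0 - Real.sin ε * x 1 ≤ a := by
  simp [wedge, height_apply, sub_eq_add_neg]

lemma mem_tip_iff {a ε : ℝ} {x : Plane} :
    x ∈ tip a ε ↔ x ∈ wedge a ε ∧ a * Real.cos ε ≤ x 0 := by
  simp [tip, height_zero]

lemma abs_coord_le_of_mem_tip {a ε : ℝ} (hε : 0 < Real.sin ε) (hε' : 0 < Real.cos ε) {x : Plane}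
    (hx : x ∈ tip a ε) : |x 1| ≤ a * Real.sin ε := by
  rw [mem_tip_iff, mem_wedge_iff] at hx
  obtain ⟨⟨h₁, h₂⟩, h₃⟩ := hx
  have h₄ := mul_le_mul_of_nonneg_left h₃ hε'.le
  have h₅ : a = a * Real.sin ε * Real.sin ε + Real.cos ε * (a * Real.cos ε) := by
    linear_combination -a * Real.sin_sq_add_cos_sq ε
  rw [abs_le]
  constructor
  · refine le_of_mul_le_mul_left ?_ hε
    linarith
  · refine le_of_mul_le_mul_left ?_ hε
    linarith

/-- The tip lies in the sector of half-angle `ε`: there `|x 1| ≤ a sin ε` and `x 0 ≥ a cos ε`, so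
the slope is at most `tan ε`. -/
lemma exists_polarPoint_of_mem_tip {a ε : ℝ} (ha : 0 < a) (hε : 0 < ε) (hε' : ε < Real.pi / 2)
    {x : Plane} (hx : x ∈ tip a ε) : ∃ θ, |θ| ≤ ε ∧ polarPoint ‖x‖ θ = x := by
  have hpi := Real.pi_pos
  have hc : 0 < Real.cos ε := Real.cos_pos_of_mem_Ioo ⟨by linarith, hε'⟩
  have hs : 0 < Real.sin ε := Real.sin_pos_of_pos_of_lt_pi hε (by linarith)
  obtain ⟨θ, hθ, hxθ⟩ := exists_polarPoint_eq x
  refine ⟨θ, ?_, hxθ⟩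
  have h₁ := abs_coord_le_of_mem_tip hs hc hx
  have h₀ : a * Real.cos ε ≤ x 0 := (mem_tip_iff.1 hx).2
  have hx0 : x 0 = ‖x‖ * Real.cos θ := by rw [← polarPoint_zero, hxθ]
  have hx1 : x 1 = ‖x‖ * Real.sin θ := by rw [← polarPoint_one, hxθ]
  refine abs_le_of_cos_le_cos hε.le hθ ?_
  have hn : 0 < ‖x‖ := norm_pos_iff.2 fun h => by
    rw [h] at h₀
    exact absurd h₀ (not_le.2 (by simpa using mul_pos ha hc))
  have h₂ : |x 1| * Real.cos ε ≤ x 0 * Real.sin ε := by nlinarith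
  have h₃ : x 1 ^ 2 * Real.cos ε ^ 2 ≤ x 0 ^ 2 * Real.sin ε ^ 2 := by
    rw [← mul_pow, ← mul_pow, ← sq_abs (x 1 * _), abs_mul, abs_of_pos hc]
    exact pow_le_pow_left₀ (by positivity) h₂ 2
  have h₄ : ‖x‖ ^ 2 * Real.cos ε ^ 2 ≤ x 0 ^ 2 := by
    rw [norm_sq_eq_coord]
    nlinarith [Real.sin_sq_add_cos_sq ε]
  rw [← mul_pow] at h₄
  have h₅ := (le_abs_self _).trans (abs_le_of_sq_le_sq h₄ ((mul_pos ha hc).le.trans h₀))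
  rw [hx0] at h₅
  exact le_of_mul_le_mul_left h₅ hn

/-- A crude bounding-box estimate suffices, since the left side of `hb'` tends to `a² < b²` as `ε →
0`. -/
lemma norm_le_of_mem_tip {a b ε : ℝ} (hb : 0 ≤ b) (hε : 0 < Real.sin ε)
    (hε' : 0 < Real.cos ε) (ha : 0 < a)
    (hb' : (a / Real.cos ε) ^ 2 + (a * Real.sin ε) ^ 2 ≤ b ^ 2) {x : Plane}
    (hx : x ∈ tip a ε) : ‖x‖ ≤ b := by
  refine abs_le_of_sq_le_sq' ?_ hb |>.2
  rw [norm_sq_eq_coord]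
  refine le_trans (add_le_add ?_ ?_) hb'
  · rw [mem_tip_iff, mem_wedge_iff] at hx
    refine pow_le_pow_left₀ ((mul_pos ha hε').le.trans hx.2) ?_ 2
    rw [le_div_iff₀ hε']
    linarith [hx.1.1, hx.1.2]
  · rw [← sq_abs (x 1)]
    exact pow_le_pow_left₀ (abs_nonneg _) (abs_coord_le_of_mem_tip hε hε' hx) 2

/-- The area between the circle of radius `a` and its tangents at the polar angles `±ε`. -/
lemma volume_tip_diff_disk_le {a ε : ℝ} (ha : 0 < a) (hε : 0 < ε) (hε' : ε < Real.pi / 2) :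
    volume (tip a ε \ disk a) ≤ ENNReal.ofReal (a ^ 2 * (Real.tan ε - ε)) := by
  have hpi := Real.pi_pos
  have htan := Real.lt_tan hε hε'
  have hcos : ∀ θ, |θ| ≤ ε → 0 < Real.cos θ := fun θ hθ =>
    Real.cos_pos_of_mem_Ioo ⟨by linarith [(abs_le.1 hθ).1], by linarith [(abs_le.1 hθ).2]⟩
  -- The bisector splits the corner: for angles in `[0, ε]` the tangent at `ε` bounds the radius,
  -- for angles in `[-ε, 0]` the one at `-ε`.
  have hv₁ : volume (polarRegion 0 ε (fun _ => a) fun θ => a / Real.cos (θ - ε)) =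
      ENNReal.ofReal (a ^ 2 * (Real.tan ε - ε) / 2) := by
    have habs : ∀ θ ∈ Set.Icc 0 ε, |θ - ε| ≤ ε := fun θ hθ =>
      abs_le.2 ⟨by linarith [hθ.1], by linarith [hθ.2]⟩
    rw [volume_polarRegion (F := fun θ => a ^ 2 * (Real.tan (θ - ε) - θ) / 2)
      (by linarith) (by linarith) hε.le (by fun_prop) (by fun_prop)]
    · congr 1
      rw [sub_self, zero_sub, Real.tan_neg, Real.tan_zero]
      ring
    · exact fun θ _ => ha.le
    · intro θ hθ
      rw [le_div_iff₀ (hcos _ (habs θ hθ))]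
      exact mul_le_of_le_one_right ha.le (Real.cos_le_one _)
    · intro θ hθ
      have h₁ := (Real.hasDerivAt_tan (hcos _ (habs θ hθ)).ne').comp_sub_const θ ε
      refine (((h₁.sub (hasDerivAt_id θ)).const_mul (a ^ 2)).div_const 2).congr_deriv ?_
      rw [div_pow]
      ring
  have hv₂ : volume (polarRegion (-ε) 0 (fun _ => a) fun θ => a / Real.cos (θ + ε)) =
      ENNReal.ofReal (a ^ 2 * (Real.tan ε - ε) / 2) := by
    have habs : ∀ θ ∈ Set.Icc (-ε) 0, |θ + ε| ≤ ε := fun θ hθ =>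
      abs_le.2 ⟨by linarith [hθ.1], by linarith [hθ.2]⟩
    rw [volume_polarRegion (F := fun θ => a ^ 2 * (Real.tan (θ + ε) - θ) / 2)
      (by linarith) (by linarith) (by linarith) (by fun_prop) (by fun_prop)]
    · congr 1
      rw [zero_add, neg_add_cancel, Real.tan_zero]
      ring
    · exact fun θ _ => ha.le
    · intro θ hθ
      rw [le_div_iff₀ (hcos _ (habs θ hθ))]
      exact mul_le_of_le_one_right ha.le (Real.cos_le_one _)
    · intro θ hθ
      have h₁ := (Real.hasDerivAt_tan (hcos _ (habs θ hθ)).ne').comp_add_const θ ε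
      refine (((h₁.sub (hasDerivAt_id θ)).const_mul (a ^ 2)).div_const 2).congr_deriv ?_
      rw [div_pow]
      ring
  have hsum : ENNReal.ofReal (a ^ 2 * (Real.tan ε - ε)) =
      volume (polarRegion 0 ε (fun _ => a) fun θ => a / Real.cos (θ - ε)) +
        volume (polarRegion (-ε) 0 (fun _ => a) fun θ => a / Real.cos (θ + ε)) := by
    have : 0 ≤ a ^ 2 * (Real.tan ε - ε) / 2 := by
      have : 0 < Real.tan ε - ε := by linarith
      positivity
    rw [hv₁, hv₂, ← ENNReal.ofReal_add this this]
    congr 1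
    ring
  rw [hsum]
  refine (measure_mono ?_).trans (measure_union_le _ _)
  rintro x ⟨hx, hxa⟩
  obtain ⟨θ, hθ, hxθ⟩ := exists_polarPoint_of_mem_tip ha hε hε' hx
  have hn : a < ‖x‖ := by simpa [disk] using hxa
  rw [abs_le] at hθ
  rcases le_total 0 θ with h | h
  · refine Or.inl ⟨‖x‖, θ, ⟨h, hθ.2⟩, ⟨hn, ?_⟩, hxθ⟩
    rw [le_div_iff₀ (hcos _ (abs_le.2 ⟨by linarith, by linarith⟩)), ← height_polarPoint, hxθ]
    exact hx.1.1
  · refine Or.inr ⟨‖x‖, θ, ⟨hθ.1, h⟩, ⟨hn, ?_⟩, hxθ⟩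
    rw [le_div_iff₀ (hcos _ (abs_le.2 ⟨by linarith, by linarith⟩)), ← sub_neg_eq_add,
      ← height_polarPoint, hxθ]
    exact hx.1.2

/-- The segment from the point of polar angle `σ` on the circle to the apex of the tip. -/
def tangentSegment (a ε σ : ℝ) : Set Plane :=
  segment ℝ (polarPoint a σ) (polarPoint (a / Real.cos ε) 0)

lemma hausdorffMeasure_tangentSegment {a ε : ℝ} (ha : 0 < a) (hε : 0 < Real.cos ε)
    (ht : 0 ≤ Real.tan ε) {σ : ℝ} (hσ : |σ| = |ε|) :
    Measure.hausdorffMeasure 1 (tangentSegment a ε σ) = ENNReal.ofReal (a * Real.tan ε) := by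
  have hcos : Real.cos σ = Real.cos ε := by rw [← Real.cos_abs, hσ, Real.cos_abs]
  rw [tangentSegment, hausdorffMeasure_segment, edist_dist, dist_eq_norm]
  congr 1
  rw [← sq_eq_sq₀ (norm_nonneg _) (by positivity), norm_sq_eq_coord]
  simp only [PiLp.sub_apply, polarPoint_zero, polarPoint_one, Real.cos_zero, Real.sin_zero, hcos,
    mul_one, mul_zero, sub_zero, mul_pow, Real.sin_sq, Real.tan_eq_sin_div_cos, div_pow]
  field_simp
  ring

lemma measurableSet_tangentSegment (a ε σ : ℝ) : MeasurableSet (tangentSegment a ε σ) := by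
  rw [tangentSegment, segment_eq_image_lineMap]
  exact (isCompact_Icc.image AffineMap.lineMap_continuous).measurableSet

lemma tangentSegment_subset_tip {a ε σ : ℝ} (ha : 0 < a) (hε : 0 < Real.cos ε)
    (hσ : |σ| = |ε|) : tangentSegment a ε σ ⊆ tip a ε := by
  have hcos : Real.cos σ = Real.cos ε := by rw [← Real.cos_abs, hσ, Real.cos_abs]
  refine (convex_tip a ε).segment_subset ⟨⟨?_, ?_⟩, ?_⟩ ⟨⟨?_, ?_⟩, ?_⟩ <;>
    simp only [Set.mem_ofPred_eq, height_polarPoint, sub_zero, zero_sub, neg_neg, Real.cos_neg,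
      Real.cos_zero, mul_one, hcos, div_mul_cancel₀ _ hε.ne', le_refl]
  · exact mul_le_of_le_one_right ha.le (Real.cos_le_one _)
  · exact mul_le_of_le_one_right ha.le (Real.cos_le_one _)
  · rw [le_div_iff₀ hε, mul_assoc]
    exact mul_le_of_le_one_right ha.le (by nlinarith [Real.cos_le_one ε])

lemma height_eq_of_mem_tangentSegment {a ε σ : ℝ} (hε : 0 < Real.cos ε)
    (hσ : |σ| = |ε|) {x : Plane} (hx : x ∈ tangentSegment a ε σ) : height σ x = a := by
  have hcos : Real.cos σ = Real.cos ε := by rw [← Real.cos_abs, hσ, Real.cos_abs]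
  obtain ⟨s, t, hs, ht, hst, rfl⟩ := hx
  simp only [map_add, map_smul, height_polarPoint, sub_self, zero_sub, Real.cos_neg, smul_eq_mul,
    Real.cos_zero, hcos, div_mul_cancel₀ _ hε.ne', mul_one]
  rw [← add_mul, hst, one_mul]

lemma aedisjoint_tangentSegment {a ε : ℝ} (hε : 0 < Real.cos ε) (hs : 0 < Real.sin ε) :
    AEDisjoint (Measure.hausdorffMeasure 1) (tangentSegment a ε ε) (tangentSegment a ε (-ε)) := by
  have := Measure.nullSingletonClass_hausdorff Plane zero_lt_one
  refine measure_mono_null (t := {polarPoint (a / Real.cos ε) 0}) ?_ (measure_singleton _)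
  rintro x ⟨hx₁, hx₂⟩
  have h₁ := height_eq_of_mem_tangentSegment hε rfl hx₁
  have h₂ := height_eq_of_mem_tangentSegment hε (abs_neg ε) hx₂
  rw [height_apply] at h₁ h₂
  rw [Real.cos_neg, Real.sin_neg] at h₂
  refine plane_ext ?_ ?_
  · rw [polarPoint_zero, Real.cos_zero, mul_one, eq_div_iff hε.ne']
    linarith
  · rw [polarPoint_one, Real.sin_zero, mul_zero]
    have : Real.sin ε * x 1 = 0 := by linarith
    exact (mul_eq_zero.1 this).resolve_left hs.ne'

/-- Adding a small corner shows that a minimizer has no arc of the inner circle. -/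
lemma IsMinimizer.not_inner_arc {a b l : ℝ} (ha : 0 < a) (hab : a < b) (hl₀ : 0 ≤ l)
    (hl : l < 2 / a) {K : Set Plane} (hK : IsMinimizer a b l K) {δ : ℝ} (hδ : 0 < δ)
    (harc : ∀ θ, |θ| < δ → polarPoint a θ ∈ frontier K) : False := by
  obtain ⟨hKc, hmin⟩ := hK
  have hb : 0 < b := ha.trans hab
  have hconv : Convex ℝ K := hKc.1
  have hb_ev : ∀ᶠ ε in nhdsWithin (0 : ℝ) (Set.Ioi 0),
      (a / Real.cos ε) ^ 2 + (a * Real.sin ε) ^ 2 < b ^ 2 := by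
    have : ContinuousAt (fun ε : ℝ => (a / Real.cos ε) ^ 2 + (a * Real.sin ε) ^ 2) 0 :=
      ((continuousAt_const.div Real.continuous_cos.continuousAt (by simp)).pow 2).add (by fun_prop)
    refine nhdsWithin_le_nhds (this.eventually (gt_mem_nhds ?_))
    simpa using pow_lt_pow_left₀ hab ha.le two_ne_zero
  obtain ⟨ε, hbε, hε, hεm⟩ := (hb_ev.and
    (Ioo_mem_nhdsGT (lt_min hδ (half_pos Real.pi_pos)))).exists
  have hεδ := hεm.trans_le (min_le_left _ _)
  have hεπ := hεm.trans_le (min_le_right _ _)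
  have hpi := Real.pi_pos
  have hcε : 0 < Real.cos ε := Real.cos_pos_of_mem_Ioo ⟨by linarith, hεπ⟩
  have hsε : 0 < Real.sin ε := Real.sin_pos_of_pos_of_lt_pi hε (by linarith)
  have htan := Real.lt_tan hε hεπ
  have hsupp : ∀ θ, |θ| ≤ ε → ∀ x ∈ closure K, height θ x ≤ a := fun θ hθ x hx =>
    height_le_of_polarPoint_mem_frontier ha hconv hKc.2.1 (harc θ (hθ.trans_lt hεδ)) hx
  have hW : closure K ⊆ wedge a ε := fun x hx =>
    ⟨hsupp ε (abs_of_pos hε).le x hx, hsupp (-ε) (by rw [abs_neg, abs_of_pos hε]) x hx⟩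
  have hKW : K ⊆ wedge a ε := subset_closure.trans hW
  set c := a * Real.cos ε with hc
  set L : Set Plane := K ∪ tip a ε with hL
  have hLW : L ⊆ wedge a ε := Set.union_subset hKW Set.inter_subset_left
  have hLc : L ∈ convexClass a b := by
    refine ⟨convex_union_inter_halfSpace hconv (convex_wedge a ε) hKW (height 0).toLinearMap c ?_,
      hKc.2.1.trans Set.subset_union_left, Set.union_subset hKc.2.2 fun x hx => ?_⟩
    -- The wedge meets the chord line only inside `D_a ⊆ K`, which is what makes the enlarged set
    -- convex.
    · rintro x ⟨hx, hxc⟩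
      have hxc : x 0 = c := by rw [← height_zero]; exact hxc
      refine hKc.2.1 ?_
      have h₁ := abs_coord_le_of_mem_tip hsε hcε (mem_tip_iff.2 ⟨hx, hxc.ge⟩)
      have h₂ := pow_le_pow_left₀ (abs_nonneg _) h₁ 2
      rw [sq_abs] at h₂
      rw [disk, mem_closedBall_zero_iff]
      refine abs_le_of_sq_le_sq' ?_ ha.le |>.2
      rw [norm_sq_eq_coord, hxc, hc]
      nlinarith [Real.sin_sq_add_cos_sq ε]
    · rw [disk, mem_closedBall_zero_iff]
      exact norm_le_of_mem_tip hb.le hsε hcε ha hbε.le hx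
  have hU : IsOpen {x : Plane | height 0 x < c} := isOpen_lt (height 0).continuous continuous_const
  set R : Set Plane := frontier K ∩ {x | height 0 x < c} with hR
  have hPK : Measure.hausdorffMeasure 1 (frontier K) ≤
      Measure.hausdorffMeasure 1 R + ENNReal.ofReal (a * (ε - -ε)) := by
    refine (measure_mono ?_).trans ((measure_union_le R (polarPoint a '' Set.Icc (-ε) ε)).trans
      (add_le_add_right (hausdorffMeasure_image_polarPoint_le ha.le _ _) _))
    intro x hx
    by_cases hxc : height 0 x < c
    · exact Or.inl ⟨hx, hxc⟩
    right
    have hxK := frontier_subset_closure hx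
    obtain ⟨θ, hθ, hxθ⟩ := exists_polarPoint_of_mem_tip ha hε hεπ ⟨hW hxK, not_lt.1 hxc⟩
    -- The tangent at the angle of `x` itself supports `K`, which forces `‖x‖ ≤ a`; a smaller norm
    -- would make `x` interior.
    have hle := hsupp θ hθ x hxK
    nth_rewrite 1 [← hxθ] at hle
    rw [height_polarPoint, sub_self, Real.cos_zero, mul_one] at hle
    rcases hle.lt_or_eq with hlt | heq
    · exact absurd (interior_mono hKc.2.1 (Metric.ball_subset_interior_closedBall
        (mem_ball_zero_iff.2 hlt))) hx.2
    · exact ⟨θ, abs_le.1 hθ, by rw [← heq, hxθ]⟩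
  have hfront : ∀ σ, |σ| = |ε| → (∀ y ∈ wedge a ε, height σ y ≤ a) →
      tangentSegment a ε σ ⊆ frontier L := fun σ hσ hσW x hx =>
    ⟨subset_closure (Or.inr (tangentSegment_subset_tip ha hcε hσ hx)),
      notMem_interior_of_forall_height_le (φ := σ) fun y hy => by
        rw [height_eq_of_mem_tangentSegment hcε hσ hx]
        exact hσW y (hLW hy)⟩
  have hPL : Measure.hausdorffMeasure 1 R + ENNReal.ofReal (a * Real.tan ε + a * Real.tan ε) ≤
      Measure.hausdorffMeasure 1 (frontier L) := by
    have htan₀ : 0 ≤ Real.tan ε := by linarith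
    rw [ENNReal.ofReal_add (by positivity) (by positivity)]
    nth_rewrite 1 [← hausdorffMeasure_tangentSegment ha hcε htan₀ (σ := ε) rfl]
    rw [← hausdorffMeasure_tangentSegment ha hcε htan₀ (abs_neg ε),
      ← measure_union₀ (measurableSet_tangentSegment a ε (-ε)).nullMeasurableSet
        (aedisjoint_tangentSegment hcε hsε), ← measure_union]
    · refine measure_mono (Set.union_subset ?_ (Set.union_subset ?_ ?_))
      · have e : L ∩ {x | height 0 x < c} = K ∩ {x | height 0 x < c} := by
          rw [hL, Set.union_inter_distrib_right, Set.union_eq_left]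
          exact fun x hx => absurd (Set.mem_ofPred.1 hx.2) (not_lt.2 (Set.mem_ofPred.1 hx.1.2))
        rw [hR, ← frontier_inter_open_inter hU, ← e, frontier_inter_open_inter hU]
        exact Set.inter_subset_left
      · exact hfront ε rfl fun y hy => hy.1
      · exact hfront (-ε) (abs_neg ε) fun y hy => hy.2
    · refine Set.disjoint_left.2 fun x hx hx' => ?_
      have hT : x ∈ tip a ε := hx'.elim (fun h => tangentSegment_subset_tip ha hcε rfl h)
        fun h => tangentSegment_subset_tip ha hcε (abs_neg ε) h
      exact absurd (Set.mem_ofPred.1 hx.2) (not_lt.2 (Set.mem_ofPred.1 hT.2))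
    · exact (measurableSet_tangentSegment a ε ε).union (measurableSet_tangentSegment a ε (-ε))
  have hvol : volume L ≤ volume K + ENNReal.ofReal (a ^ 2 * (Real.tan ε - ε)) := by
    refine (measure_mono (t := K ∪ tip a ε \ disk a) ?_).trans ((measure_union_le _ _).trans
      (add_le_add_right (volume_tip_diff_disk_le ha hε hεπ) _))
    rintro x (hx | hx)
    · exact Or.inl hx
    · by_cases hxa : x ∈ disk a
      · exact Or.inl (hKc.2.1 hxa)
      · exact Or.inr ⟨hx, hxa⟩
  have hv₀ : 0 ≤ a ^ 2 * (Real.tan ε - ε) := mul_nonneg (by positivity) (by linarith)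
  have hKtop := volume_ne_top_of_mem_convexClass hKc
  have harea := ENNReal.toReal_mono (by finiteness) hvol
  rw [ENNReal.toReal_add hKtop ENNReal.ofReal_ne_top, ENNReal.toReal_ofReal hv₀] at harea
  refine absurd (hmin hLc) (not_le.2 (functional_lt_of_bounds ha hab hKc hLc (R := R)
    (d := l * (a ^ 2 * (Real.tan ε - ε))) (by nlinarith) (by nlinarith)
    Set.inter_subset_left hPK hPL ?_ ?_))
  · refine mul_le_mul_of_nonneg_left ?_ hl₀
    rw [area, area]
    linarith
  -- Both increments are multiples of `tan ε - ε > 0`, so no asymptotic expansion is needed.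
  · rw [lt_div_iff₀ ha] at hl
    nlinarith [mul_lt_mul_of_pos_right hl (mul_pos ha (sub_pos.2 htan))]

end AnnulusProblem

end

theorem theorem2p1 (a b l : ℝ) (ha : 0 < a) (hab : a < b)
    (hl₁ : 1 / (2 * b) < l) (hl₂ : l < 2 / a)
    (K : Set AnnulusProblem.Plane) (hK : AnnulusProblem.IsMinimizer a b l K) :
    ¬ AnnulusProblem.ContainsArc (frontier K) a ∧
      ¬ AnnulusProblem.ContainsArc (frontier K) b := by
  have hb : 0 < b := ha.trans hab
  have hl₀ : 0 ≤ l := le_trans (by positivity) hl₁.le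
  constructor <;> intro h <;>
    obtain ⟨L, hL, δ, hδ, harc⟩ := AnnulusProblem.exists_isMinimizer_of_containsArc hK h
  · exact hL.not_inner_arc ha hab hl₀ hl₂ hδ harc
  · exact hL.not_outer_arc ha hab hl₁ hδ harc
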